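/- Let $\mathcal H$ be an infinite-dimensional separable complex Hilbert space with an orthonormal basis $\{e_j\}_{j\in\mathbb N}$, let $\mathcal E$ be the set of compact operators on $\mathcal H$, let $\mathcal F$ be the family of closed subsets of $\mathbb C$, and let $\Xi:\mathcal E\to\mathcal F$ be given by $\Xi(T)=\sigma(T)$, the spectrum. Then the Solvability Complexity Index of $\Xi$ equals one: \[ \mathrm{SCI}(\Xi)=1 . \] Here the notions are as follows. For $T\in\mathcal E$ put $x_{ij}=\langle Te_j,e_i\rangle$, and let $\Pi_{\mathcal E}$ be the set of all the infinite matrices $\{x_{ij}\}_{i,j\in\mathbb N}$ that arise in this way. A set-valued function of matrix elements *is evaluated by finitely many arithmetic operations and radicals* if there is a deterministic procedure that computes with complex numbers (treated as pairs of real numbers), starting from the matrix elements and rational constants, that uses the operations $+,-,\cdot,/$, $k$-th roots ($k\ge 1$), complex conjugation and comparison of real parts with $0$ (with branching), and that on every admissible input stops after finitely many steps and returns the value of the function as a finite list of the elements of a (possibly empty) finite subset of $\mathbb C$. A *set of estimating functions of order $k\ge1$ for $\Xi$* is a family of functions $\Gamma_{n_1,\dots,n_j}:\Pi_{\mathcal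 E}\to\mathcal F$, for $1\le j\le k$ and $n_1,\dots,n_j\in\mathbb N$, such that 1. for each $(n_1,\dots,n_k)$ there is an integer $N=N(n_1,\dots,n_k)$, independent of the matrix, such that $\Gamma_{n_1,\dots,n_k}(\{x_{ij}\})$ depends only on the elements $x_{ij}$ with $i,j\le N$ and is evaluated by finitely many arithmetic operations and radicals of them; 2. for every $T\in\mathcal E$ with matrix $\{x_{ij}\}$, $\Xi(T)=\lim_{n_1\to\infty}\Gamma_{n_1}(\{x_{ij}\})$ and $\Gamma_{n_1,\dots,n_{j}}(\{x_{ij}\})=\lim_{n_{j+1}\to\infty}\Gamma_{n_1,\dots,n_{j+1}}(\{x_{ij}\})$ for $1\le j<k$, all limits being in the Attouch–Wets metric \[ d_{\mathrm{AW}}(\Sigma,\Lambda)=\sum_{i=1}^\infty 2^{-i}\min\Bigl\{1,\sup_{|x|<i}\bigl|d(x,\Sigma)-d(x,\Lambda)\bigr|\Bigr\},\qquad d(x,\Sigma)=\inf_{\rho\in\Sigma}|x-\rho| \] (with $d(x,\emptyset)=\infty$ and $|\infty-\infty|=0$). Finally, $\mathrm{SCI}(\Xi)=0$ if $\Xi(T)$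 itself is evaluated by finitely many arithmetic operations and radicals of finitely many of the matrix elements $x_{ij}$ of $T$; otherwise $\mathrm{SCI}(\Xi)$ is the smallest $k\ge1$ for which there is a set of estimating functions of order $k$ for $\Xi$, and $\infty$ if there is none. -/

import Mathlib

open Filter Topology TopologicalSpace
open scoped ENNReal

noncomputable section

namespace SolvabilityComplexity

/-! ### Attouch–Wets distance -/

/-- The Attouch–Wets distance
`∑_{i ≥ 1} 2^{-i} min {1, sup_{|x| < i} |d(x, A) - d(x, B)|}` of closed subsets of `ℂ`.
Everything lives in `[0, ∞]`, so that `d(x, ∅) = ∞`; the absolute value of a difference is written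
as the larger of the two truncated differences (in particular `|∞ - ∞| = 0`). -/
def attouchWets (A B : Closeds ℂ) : ℝ≥0∞ :=
  ∑' i : ℕ, (2⁻¹ : ℝ≥0∞) ^ (i + 1) *
    min 1 (⨆ x ∈ Metric.ball (0 : ℂ) (i + 1),
      max (Metric.infEDist x (A : Set ℂ) - Metric.infEDist x (B : Set ℂ))
        (Metric.infEDist x (B : Set ℂ) - Metric.infEDist x (A : Set ℂ)))

/-- Convergence of a sequence of closed sets in the Attouch–Wets distance. -/
def AWTendsto (A : ℕ → Closeds ℂ) (B : Closeds ℂ) : Prop :=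
  Tendsto (fun n => attouchWets (A n) B) atTop (𝓝 0)

/-! ### Evaluation by finitely many arithmetic operations and radicals -/

/-- Expressions built from complex inputs (indexed by `ι`) and rational numbers by finitely many
arithmetic operations, radicals, and complex conjugation.  Conjugation gives access to real and
imaginary parts, i.e. a complex number is treated as a pair of real numbers. -/
inductive RadicalExpr (ι : Type) : Type
  | entry (p : ι) : RadicalExpr ι
  | rat (q : ℚ) : RadicalExpr ι
  | add (s t : RadicalExpr ι) : RadicalExpr ι
  | sub (s t : RadicalExpr ι) : RadicalExpr ι
  | mul (s t : RadicalExpr ι) : RadicalExpr ι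
  | div (s t : RadicalExpr ι) : RadicalExpr ι
  | conj (t : RadicalExpr ι) : RadicalExpr ι
  | root (k : ℕ+) (t : RadicalExpr ι) : RadicalExpr ι

/-- The value of an expression.  `root k` is the principal `k`-th root; the other `k`-th roots are
obtained by multiplying with roots of unity, which are themselves products of principal roots of
`-1`.  Division by zero returns `0`: as an algorithm may test whether a number vanishes before it
divides, this convention does not affect what can be evaluated. -/
def RadicalExpr.eval {ι : Type} (x : ι → ℂ) : RadicalExpr ι → ℂ
  | .entry p => x p
  | .rat q => (q : ℂ)
  | .add s t => s.eval x + t.eval x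
  | .sub s t => s.eval x - t.eval x
  | .mul s t => s.eval x * t.eval x
  | .div s t => s.eval x / t.eval x
  | .conj t => (starRingEnd ℂ) (t.eval x)
  | .root k t => (t.eval x) ^ (((k : ℕ) : ℂ)⁻¹)

/-- One instruction of an algorithm: either compare the real part of a computed number with `0`,
or stop and return a finite list of computed numbers. -/
inductive Instruction (ι : Type) : Type
  | test (t : RadicalExpr ι) : Instruction ι
  | output (l : List (RadicalExpr ι)) : Instruction ι

/-- An algorithm is a binary decision tree; a vertex of the tree is addressed by the list of
outcomes of the tests on the way from the root to it (the most recent outcome comes first). -/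
def Algorithm (ι : Type) : Type := List Bool → Instruction ι

/-- `p.Run x h S`: on the input `x`, starting at the vertex `h`, the algorithm `p` stops after
finitely many steps, and the finite set of numbers that it returns is `S`. -/
inductive Algorithm.Run {ι : Type} (p : Algorithm ι) (x : ι → ℂ) : List Bool → Set ℂ → Prop
  | output (h : List Bool) (l : List (RadicalExpr ι)) (hp : p h = Instruction.output l) :
      Algorithm.Run p x h {z | ∃ t ∈ l, t.eval x = z}
  | pos (h : List Bool) (t : RadicalExpr ι) (S : Set ℂ) (hp : p h = Instruction.test t)
      (ht : 0 < (t.eval x).re) (hS : Algorithm.Run p x (true :: h) S) : Algorithm.Run p x h S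
  | nonpos (h : List Bool) (t : RadicalExpr ι) (S : Set ℂ) (hp : p h = Instruction.test t)
      (ht : (t.eval x).re ≤ 0) (hS : Algorithm.Run p x (false :: h) S) : Algorithm.Run p x h S

/-- On the input `x`, the algorithm `p` stops after finitely many steps and returns `S`. -/
def Algorithm.Evaluates {ι : Type} (p : Algorithm ι) (x : ι → ℂ) (S : Set ℂ) : Prop :=
  p.Run x [] S

/-! ### The Solvability Complexity Index -/

variable {H : Type*} [NormedAddCommGroup H] [InnerProductSpace ℂ H]

/-- The matrix elements `x i j = ⟨T e_j, e_i⟩` (linear in `T e_j`) in the orthonormal basis `e`. -/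
def matrixElements (e : HilbertBasis ℕ ℂ H) (T : H →L[ℂ] H) : ℕ → ℕ → ℂ :=
  fun i j => inner ℂ (e i) (T (e j))

/-- The set of the infinite matrices of the operators in `E`. -/
def matrixSet (e : HilbertBasis ℕ ℂ H) (E : Set (H →L[ℂ] H)) : Set (ℕ → ℕ → ℂ) :=
  matrixElements e '' E

/-- The matrix of an element of `E`, as an element of `matrixSet e E`. -/
def matrixOf (e : HilbertBasis ℕ ℂ H) {E : Set (H →L[ℂ] H)} (T : E) : matrixSet e E :=
  ⟨matrixElements e (T : H →L[ℂ] H), ⟨(T : H →L[ℂ] H), T.2, rfl⟩⟩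

/-- `Γ` is a set of estimating functions of order `k` (for `1 ≤ k`) for `Ξ`.  The function
`Γ_{n₁, …, n_j}` is `Γ [n₁, …, n_j]` for `1 ≤ j ≤ k`; moreover `Γ []` stands for `Ξ` itself, read
as a function of the matrix elements, and `Γ l` plays no role for lists longer than `k`. -/
structure IsEstimatingFamily (e : HilbertBasis ℕ ℂ H) (E : Set (H →L[ℂ] H))
    (Ξ : E → Closeds ℂ) (k : ℕ) (Γ : List ℕ → matrixSet e E → Closeds ℂ) : Prop where
  /-- `Γ_{n₁, …, n_k}` only uses the elements `x i j` with `i, j < N`, where `N` depends on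
  `n₁, …, n_k` only, and is evaluated by arithmetic operations and radicals of them. -/
  evaluation : ∀ l : List ℕ, l.length = k →
    ∃ (N : ℕ) (p : Algorithm (Fin N × Fin N)), ∀ x : matrixSet e E,
      p.Evaluates (fun q => x.1 q.1 q.2) (Γ l x : Set ℂ)
  /-- `Γ_{n₁, …, n_j}` is the limit of `Γ_{n₁, …, n_j, n}` as `n → ∞`, for `0 ≤ j < k`. -/
  limit : ∀ l : List ℕ, l.length < k → ∀ x : matrixSet e E,
    AWTendsto (fun n => Γ (l ++ [n]) x) (Γ l x)
  /-- The outermost limit is `Ξ`. -/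
  target : ∀ T : E, Γ [] (matrixOf e T) = Ξ T

/-- `Ξ` is solvable with `k` limits: for `k = 0`, the set `Ξ T` itself is evaluated by finitely many
arithmetic operations and radicals of finitely many matrix elements of `T`; for `1 ≤ k`, there is a
set of estimating functions of order `k` for `Ξ`. -/
def SolvableWithLimits (e : HilbertBasis ℕ ℂ H) (E : Set (H →L[ℂ] H)) (Ξ : E → Closeds ℂ) :
    ℕ → Prop
  | 0 => ∃ p : Algorithm (ℕ × ℕ), ∀ T : E,
      p.Evaluates (fun q => matrixElements e (T : H →L[ℂ] H) q.1 q.2) (Ξ T : Set ℂ)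
  | k + 1 => ∃ Γ : List ℕ → matrixSet e E → Closeds ℂ, IsEstimatingFamily e E Ξ (k + 1) Γ

/-- The Solvability Complexity Index of `Ξ`: the smallest `k` such that `Ξ` is solvable with `k`
limits, and `⊤` if there is no such `k`. -/
def SCI (e : HilbertBasis ℕ ℂ H) (E : Set (H →L[ℂ] H)) (Ξ : E → Closeds ℂ) : ℕ∞ :=
  ⨅ (k : ℕ) (_ : SolvableWithLimits e E Ξ k), (k : ℕ∞)

/-- The spectrum of a bounded operator as a closed subset of `ℂ`. -/
def closedSpectrum [CompleteSpace H] (T : H →L[ℂ] H) : Closeds ℂ :=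
  ⟨spectrum ℂ T, spectrum.isClosed T⟩

end SolvabilityComplexity

end

/-! One limit suffices because, for compact `T`, the compressions `P_n T P_n` converge to `T` in
norm, so an eigenvalue search on finite sections converges with no spurious points. At stage `m` the
grid points `z` of mesh `m⁻²` in the square `[-m, m]²` are kept when `A = z - T_m` has a singular
value of order at most `1/m`. The test is `m³ |det A|² ≤ ‖adj A‖²` in the Frobenius norm: it
involves no division, makes sense for singular `A`, and is decided exactly from the entries.

A kept point has a vector `u` with `‖z u - T u‖ ≤ (1/m + ‖P_m T P_m - T‖) ‖u‖`, hence is near `σ(T)`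
by compactness and continuity of the resolvent (`exists_mem_spectrum_of_norm_smul_sub_le`).
Conversely, a nonzero spectral point of `T` is approached by eigenvalues of the sections
(`eventually_exists_mem_spectrum`, by the maximum principle for resolvents), and a grid point near
such an eigenvalue passes the test. The point `0` always lies in `σ(T)` and is put in by hand. This
gives Hausdorff convergence, which dominates Attouch–Wets.

Zero limits do not suffice: a terminating run on `T = 0` reads finitely many entries and cannot
distinguish `0` from the rank-one projection onto a basis vector of large index. -/

noncomputable section

namespace SolvabilityComplexity

/-! ### Expressible functions -/

/-- A function of the inputs that is the value of a radical expression. -/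
def IsExpressible {ι : Type} (f : (ι → ℂ) → ℂ) : Prop :=
  ∃ t : RadicalExpr ι, ∀ x, t.eval x = f x

namespace IsExpressible

variable {ι : Type} {f g : (ι → ℂ) → ℂ}

theorem entry (p : ι) : IsExpressible (fun x : ι → ℂ => x p) := ⟨.entry p, fun _ => rfl⟩

theorem rat (q : ℚ) : IsExpressible (fun _ : ι → ℂ => (q : ℂ)) := ⟨.rat q, fun _ => rfl⟩

theorem add (hf : IsExpressible f) (hg : IsExpressible g) :
    IsExpressible (fun x => f x + g x) := by
  obtain ⟨s, hs⟩ := hf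
  obtain ⟨t, ht⟩ := hg
  exact ⟨.add s t, fun x => by simp [RadicalExpr.eval, hs, ht]⟩

theorem sub (hf : IsExpressible f) (hg : IsExpressible g) :
    IsExpressible (fun x => f x - g x) := by
  obtain ⟨s, hs⟩ := hf
  obtain ⟨t, ht⟩ := hg
  exact ⟨.sub s t, fun x => by simp [RadicalExpr.eval, hs, ht]⟩

theorem mul (hf : IsExpressible f) (hg : IsExpressible g) :
    IsExpressible (fun x => f x * g x) := by
  obtain ⟨s, hs⟩ := hf
  obtain ⟨t, ht⟩ := hg
  exact ⟨.mul s t, fun x => by simp [RadicalExpr.eval, hs, ht]⟩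

theorem conj (hf : IsExpressible f) : IsExpressible (fun x => (starRingEnd ℂ) (f x)) := by
  obtain ⟨s, hs⟩ := hf
  exact ⟨.conj s, fun x => by simp [RadicalExpr.eval, hs]⟩

theorem I : IsExpressible (fun _ : ι → ℂ => Complex.I) := by
  refine ⟨.root 2 (.rat (-1)), fun x => ?_⟩
  have h : ((-1 : ℂ)) ^ ((2 : ℂ)⁻¹) = Complex.I := by
    rw [Complex.cpow_def_of_ne_zero (by norm_num), Complex.log_neg_one]
    rw [show (Real.pi : ℂ) * Complex.I * 2⁻¹ = (Real.pi : ℂ) / 2 * Complex.I by ring]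
    exact Complex.exp_pi_div_two_mul_I
  simpa [RadicalExpr.eval] using h

theorem sum {α : Type*} (s : Finset α) {F : α → (ι → ℂ) → ℂ} (hF : ∀ a, IsExpressible (F a)) :
    IsExpressible (fun x => ∑ a ∈ s, F a x) := by
  classical
  induction s using Finset.induction_on with
  | empty => simpa using rat (ι := ι) 0
  | insert a s ha ih => simpa [Finset.sum_insert ha] using (hF a).add ih

theorem prod {α : Type*} (s : Finset α) {F : α → (ι → ℂ) → ℂ} (hF : ∀ a, IsExpressible (F a)) :
    IsExpressible (fun x => ∏ a ∈ s, F a x) := by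
  classical
  induction s using Finset.induction_on with
  | empty => simpa using rat (ι := ι) 1
  | insert a s ha ih => simpa [Finset.prod_insert ha] using (hF a).mul ih

theorem det {n : Type*} [Fintype n] [DecidableEq n] {A : (ι → ℂ) → Matrix n n ℂ}
    (hA : ∀ i j, IsExpressible (fun x => A x i j)) : IsExpressible (fun x => (A x).det) := by
  simp only [Matrix.det_apply']
  refine sum _ fun σ => mul ?_ (prod _ fun i => hA _ _)
  simpa using rat (ι := ι) ((Equiv.Perm.sign σ : ℤ) : ℚ)

theorem adjugate {n : Type*} [Fintype n] [DecidableEq n] {A : (ι → ℂ) → Matrix n n ℂ}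
    (hA : ∀ i j, IsExpressible (fun x => A x i j)) (i j : n) :
    IsExpressible (fun x => (A x).adjugate i j) := by
  simp only [Matrix.adjugate_apply]
  refine det fun k l => ?_
  by_cases hk : k = j
  · subst hk
    by_cases hl : l = i
    · subst hl
      simpa using rat (ι := ι) 1
    · simpa [Pi.single_apply, hl] using rat (ι := ι) 0
  · simpa [Matrix.updateRow_apply, hk] using hA k l

end IsExpressible

/-! ### Algorithms -/

namespace Algorithm

variable {ι : Type}

/-- The algorithm that tests `t` and then continues with `p` or with `q`. -/
def branch (t : RadicalExpr ι) (p q : Algorithm ι) : Algorithm ι := fun h =>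
  match h.getLast? with
  | none => .test t
  | some true => p h.dropLast
  | some false => q h.dropLast

theorem branch_append_true (t : RadicalExpr ι) (p q : Algorithm ι) (h : List Bool) :
    branch t p q (h ++ [true]) = p h := by
  simp [branch]

theorem branch_append_false (t : RadicalExpr ι) (p q : Algorithm ι) (h : List Bool) :
    branch t p q (h ++ [false]) = q h := by
  simp [branch]

/-- Histories list the most recent outcome first, so the outcome at the root is the last element;
the subtree below outcome `b` consists of the addresses `h ++ [b]`. -/
theorem Run.append {p r : Algorithm ι} {x : ι → ℂ} {h : List Bool} {S : Set ℂ} (b : Bool)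
    (hr : ∀ h, r (h ++ [b]) = p h) (H : p.Run x h S) : r.Run x (h ++ [b]) S := by
  induction H with
  | output h l hp => exact .output _ l ((hr h).trans hp)
  | pos h t S hp ht _ ih => exact .pos _ t S ((hr h).trans hp) ht ih
  | nonpos h t S hp ht _ ih => exact .nonpos _ t S ((hr h).trans hp) ht ih

theorem Evaluates.branch_pos {t : RadicalExpr ι} {p : Algorithm ι} (q : Algorithm ι) {x : ι → ℂ}
    {S : Set ℂ} (ht : 0 < (t.eval x).re) (H : p.Evaluates x S) :
    (branch t p q).Evaluates x S :=
  .pos [] t S rfl ht (Run.append (h := []) true (branch_append_true t p q) H)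

theorem Evaluates.branch_nonpos {t : RadicalExpr ι} (p : Algorithm ι) {q : Algorithm ι} {x : ι → ℂ}
    {S : Set ℂ} (ht : (t.eval x).re ≤ 0) (H : q.Evaluates x S) :
    (branch t p q).Evaluates x S :=
  .nonpos [] t S rfl ht (Run.append (h := []) false (branch_append_false t p q) H)

/-- Selecting the members of a finite list that pass a test, in addition to given numbers. -/
theorem exists_evaluates_selection {α : Type*} (L : List α) {c v : α → (ι → ℂ) → ℂ}
    (hc : ∀ a, IsExpressible (c a)) (hv : ∀ a, IsExpressible (v a)) (l : List (RadicalExpr ι)) :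
    ∃ p : Algorithm ι, ∀ x, p.Evaluates x
      ({z | ∃ t ∈ l, t.eval x = z} ∪ {z | ∃ a ∈ L, (c a x).re ≤ 0 ∧ v a x = z}) := by
  induction L generalizing l with
  | nil =>
    refine ⟨fun _ => .output l, fun x => ?_⟩
    simpa using! Run.output (p := fun _ => .output l) (x := x) [] l rfl
  | cons a L ih =>
    obtain ⟨s, hs⟩ := hc a
    obtain ⟨t, ht⟩ := hv a
    obtain ⟨p, hp⟩ := ih l
    -- A candidate is accepted on the nonpositive outcome; the continuation then has `t` already on
    -- its output list.
    obtain ⟨q, hq⟩ := ih (t :: l)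
    refine ⟨branch s p q, fun x => ?_⟩
    rcases lt_or_ge 0 (s.eval x).re with h | h
    · convert (hp x).branch_pos q h using 1
      rw [hs] at h
      simp [h.not_ge]
    · convert (hq x).branch_nonpos p h using 1
      rw [hs] at h
      ext z
      simp only [List.mem_cons, exists_eq_or_imp, Set.mem_union, Set.mem_ofPred_eq, h, true_and, ht]
      rw [or_left_comm, or_assoc]

/-- Determinism: for the lower bound, one run valid on two inputs forces the two prescribed outputs
to coincide. -/
theorem Run.unique {p : Algorithm ι} {x : ι → ℂ} {h : List Bool} {S S' : Set ℂ}
    (H : p.Run x h S) (H' : p.Run x h S') : S = S' := by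
  induction H with
  | output h l hp =>
    cases H' with
    | output _ l' hp' =>
      obtain rfl : l = l' := by simpa [hp] using hp'
      rfl
    | pos _ t _ hp' => simp [hp] at hp'
    | nonpos _ t _ hp' => simp [hp] at hp'
  | pos h t S hp ht _ ih =>
    cases H' with
    | output _ l' hp' => simp [hp] at hp'
    | pos _ t _ hp' _ hS => exact ih hS
    | nonpos _ t' _ hp' ht' hS =>
      obtain rfl : t = t' := by simpa [hp] using hp'
      exact absurd ht ht'.not_gt
  | nonpos h t S hp ht _ ih =>
    cases H' with
    | output _ l' hp' => simp [hp] at hp'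
    | nonpos _ t _ hp' _ hS => exact ih hS
    | pos _ t' _ hp' ht' hS =>
      obtain rfl : t = t' := by simpa [hp] using hp'
      exact absurd ht' ht.not_gt

end Algorithm

theorem RadicalExpr.exists_finset_eval_eq {ι : Type} (t : RadicalExpr ι) :
    ∃ F : Finset ι, ∀ x y : ι → ℂ, (∀ i ∈ F, y i = x i) → t.eval y = t.eval x := by
  classical
  have union {s t : RadicalExpr ι}
      (hs : ∃ F : Finset ι, ∀ x y : ι → ℂ, (∀ i ∈ F, y i = x i) → s.eval y = s.eval x)
      (ht : ∃ F : Finset ι, ∀ x y : ι → ℂ, (∀ i ∈ F, y i = x i) → t.eval y = t.eval x) :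
      ∃ F : Finset ι, ∀ x y : ι → ℂ, (∀ i ∈ F, y i = x i) →
        s.eval y = s.eval x ∧ t.eval y = t.eval x := by
    obtain ⟨F, hF⟩ := hs
    obtain ⟨G, hG⟩ := ht
    exact ⟨F ∪ G, fun x y h => ⟨hF x y fun i hi => h i (by simp [hi]),
      hG x y fun i hi => h i (by simp [hi])⟩⟩
  induction t with
  | entry p => exact ⟨{p}, fun x y h => h p (by simp)⟩
  | rat q => exact ⟨∅, fun x y h => rfl⟩
  | add s t hs ht | sub s t hs ht | mul s t hs ht | div s t hs ht =>
    obtain ⟨F, hF⟩ := union hs ht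
    exact ⟨F, fun x y h => by simp [RadicalExpr.eval, hF x y h]⟩
  | conj t ht | root k t ht =>
    obtain ⟨F, hF⟩ := ht
    exact ⟨F, fun x y h => by simp [RadicalExpr.eval, hF x y h]⟩

/-- A terminating run depends on finitely many inputs only. -/
theorem Algorithm.Run.exists_finset {ι : Type} {p : Algorithm ι} {x : ι → ℂ} {h : List Bool}
    {S : Set ℂ} (H : p.Run x h S) :
    ∃ F : Finset ι, ∀ y : ι → ℂ, (∀ i ∈ F, y i = x i) → p.Run y h S := by
  classical
  induction H with
  | output h l hp =>
    choose F hF using fun t : RadicalExpr ι => t.exists_finset_eval_eq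
    refine ⟨l.toFinset.biUnion F, fun y hy => ?_⟩
    convert Algorithm.Run.output (x := y) h l hp using 1
    ext z
    refine exists_congr fun t => and_congr_right fun ht => ?_
    rw [hF t x y fun i hi => hy i (Finset.mem_biUnion.2 ⟨t, by simpa using ht, hi⟩)]
  | pos h t S hp ht _ ih =>
    obtain ⟨F, hF⟩ := ih
    obtain ⟨G, hG⟩ := t.exists_finset_eval_eq
    refine ⟨F ∪ G, fun y hy => .pos h t S hp ?_ (hF y fun i hi => hy i (by simp [hi]))⟩
    rwa [hG x y fun i hi => hy i (by simp [hi])]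
  | nonpos h t S hp ht _ ih =>
    obtain ⟨F, hF⟩ := ih
    obtain ⟨G, hG⟩ := t.exists_finset_eval_eq
    refine ⟨F ∪ G, fun y hy => .nonpos h t S hp ?_ (hF y fun i hi => hy i (by simp [hi]))⟩
    rwa [hG x y fun i hi => hy i (by simp [hi])]

variable {H : Type*} [NormedAddCommGroup H] [InnerProductSpace ℂ H]

/-! ### Spectra of compact operators and their perturbations -/

open InnerProductSpace in
/-- The spectrum of a compact operator accumulates at most at `0`. -/
theorem finite_spectrum_of_isCompactOperator [CompleteSpace H] {T : H →L[ℂ] H}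
    (hT : IsCompactOperator T) {c : ℝ} (hc : 0 < c) : {μ ∈ spectrum ℂ T | c ≤ ‖μ‖}.Finite := by
  by_contra hinf
  let f := Set.Infinite.natEmbedding _ hinf
  let μ : ℕ → ℂ := fun n => (f n).1
  have hμ : ∀ n, c ≤ ‖μ n‖ := fun n => (f n).2.2
  have hinj : Function.Injective μ := Subtype.val_injective.comp f.injective
  have hev : ∀ n, ∃ v, Module.End.HasEigenvector (T : Module.End ℂ H) (μ n) v := fun n =>
    ((hT.hasEigenvalue_iff_mem_spectrum (norm_pos_iff.1 (hc.trans_le (hμ n)))).2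
      (f n).2.1).exists_hasEigenvector
  choose v hv using hev
  have hTv : ∀ n, T (v n) = μ n • v n := fun n => (hv n).apply_eq_smul
  have hli : LinearIndependent ℂ v :=
    Module.End.eigenvectors_linearIndependent' (T : Module.End ℂ H) μ hinj v hv
  -- Riesz's argument: in the orthonormalised flag of eigenvectors `T` is upper triangular with
  -- diagonal `μ k`. So `T (x k) - T (x j)`, for `j < k`, has component `μ k` along `x k`, and `T (x
  -- n)` has no Cauchy subsequence.
  let x := gramSchmidtNormed ℂ v
  have hx : Orthonormal ℂ x := gramSchmidtNormed_orthonormal hli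
  have hspan : ∀ s : Set ℕ, Submodule.span ℂ (x '' s) = Submodule.span ℂ (gramSchmidt ℂ v '' s) :=
    fun s => span_gramSchmidtNormed v s
  have hmem : ∀ k, x k ∈ Submodule.span ℂ (v '' Set.Iic k) := fun k => by
    rw [← span_gramSchmidt_Iic, ← hspan]
    exact Submodule.subset_span ⟨k, Set.mem_Iic.2 le_rfl, rfl⟩
  have horth : ∀ k, ∀ u ∈ Submodule.span ℂ (v '' Set.Iio k), inner ℂ (x k) u = 0 := by
    intro k u hu
    rw [← span_gramSchmidt_Iio, ← hspan] at hu
    induction hu using Submodule.span_induction with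
    | mem u hu =>
      obtain ⟨j, hj, rfl⟩ := hu
      exact hx.2 (ne_of_gt hj)
    | zero => simp
    | add u w _ _ hu hw => simp [hu, hw]
    | smul a u _ hu => simp [hu]
  have hinv : ∀ k, ∀ u ∈ Submodule.span ℂ (v '' Set.Iio k),
      T u ∈ Submodule.span ℂ (v '' Set.Iio k) := by
    intro k u hu
    induction hu using Submodule.span_induction with
    | mem u hu =>
      obtain ⟨j, hj, rfl⟩ := hu
      rw [hTv]
      exact Submodule.smul_mem _ _ (Submodule.subset_span ⟨j, hj, rfl⟩)
    | zero => simp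
    | add u w _ _ hu hw => simpa using add_mem hu hw
    | smul a u _ hu => simpa using Submodule.smul_mem _ a hu
  have hshift : ∀ k, ∀ u ∈ Submodule.span ℂ (v '' Set.Iic k),
      T u - μ k • u ∈ Submodule.span ℂ (v '' Set.Iio k) := by
    intro k u hu
    induction hu using Submodule.span_induction with
    | mem u hu =>
      obtain ⟨j, hj, rfl⟩ := hu
      rw [hTv, ← sub_smul]
      rcases (show j ≤ k from hj).lt_or_eq with h | rfl
      · exact Submodule.smul_mem _ _ (Submodule.subset_span ⟨j, h, rfl⟩)
      · simp
    | zero => simp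
    | add u w _ _ hu hw =>
      convert add_mem hu hw using 1
      rw [map_add]
      module
    | smul a u _ hu =>
      convert Submodule.smul_mem _ a hu using 1
      rw [map_smul]
      module
  have hsep : ∀ j k, j < k → c ≤ ‖T (x k) - T (x j)‖ := by
    intro j k hjk
    have h1 : inner ℂ (x k) (T (x j)) = 0 := horth k _ <| hinv k _ <|
      Submodule.span_mono (Set.image_mono fun i hi => lt_of_le_of_lt hi hjk) (hmem j)
    have h2 : inner ℂ (x k) (T (x k)) = μ k := by
      have := horth k _ (hshift k _ (hmem k))
      rw [inner_sub_right, inner_smul_right, sub_eq_zero] at this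
      rw [this, inner_self_eq_norm_sq_to_K, hx.1 k]
      simp
    calc c ≤ ‖μ k‖ := hμ k
      _ = ‖inner ℂ (x k) (T (x k) - T (x j))‖ := by rw [inner_sub_right, h1, h2, sub_zero]
      _ ≤ ‖x k‖ * ‖T (x k) - T (x j)‖ := norm_inner_le_norm _ _
      _ = _ := by rw [hx.1 k, one_mul]
  obtain ⟨K, hK, hK'⟩ := IsCompactOperator.image_closedBall_subset_compact
    (f := (T : H →ₗ[ℂ] H)) hT 1
  obtain ⟨y, -, φ, hφ, hy⟩ :=
    hK.tendsto_subseq (x := fun n => T (x n)) (fun n => hK' ⟨x n, by simp [hx.1 n], rfl⟩)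
  obtain ⟨N, hN⟩ := Metric.cauchySeq_iff'.1 hy.cauchySeq c hc
  have := hN (N + 1) (Nat.le_succ N)
  rw [dist_eq_norm] at this
  exact (hsep _ _ (hφ (Nat.lt_succ_self N))).not_gt this

/-- The spectrum of an element of a Banach algebra that meets a disc but not its boundary circle
cannot leave the closed disc under a small perturbation. -/
theorem exists_mem_spectrum_of_norm_sub_lt {A : Type*} [NormedRing A] [NormedAlgebra ℂ A]
    [CompleteSpace A] {a : A} {z : ℂ} {r : ℝ} (hz : z ∈ spectrum ℂ a)
    (hr : Metric.sphere z r ⊆ resolventSet ℂ a) (hr0 : 0 < r) :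
    ∃ ε > 0, ∀ b : A, ‖b - a‖ < ε → ∃ w ∈ spectrum ℂ b, dist w z ≤ r := by
  have hcont : ∀ d : A, ContinuousOn (resolvent d) (resolventSet ℂ d) := fun d w hw =>
    (spectrum.hasDerivAt_resolvent_const_left hw).continuousAt.continuousWithinAt
  obtain ⟨C, hC⟩ := (isCompact_sphere z r).exists_bound_of_continuousOn ((hcont a).mono hr)
  -- With this bound `‖b - a‖ ‖resolvent a w‖ ≤ 1/2` on the circle, so the resolvent identity bounds
  -- `resolvent b` there by `2 (|C| + 1)`.
  refine ⟨1 / (4 * (|C| + 1)), by positivity, fun b hb => ?_⟩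
  by_contra! hcon
  have hres : Metric.closedBall z r ⊆ resolventSet ℂ b := fun w hw => by
    by_contra hw'
    exact (hcon w hw').not_ge hw
  rw [lt_div_iff₀ (by positivity)] at hb
  have hC1 : ∀ w ∈ Metric.sphere z r, ‖resolvent a w‖ ≤ |C| + 1 := fun w hw =>
    (hC w hw).trans ((le_abs_self C).trans (by linarith))
  have hbound : ∀ w ∈ Metric.sphere z r, ‖resolvent b w‖ ≤ 2 * (|C| + 1) := fun w hw => by
    have h1 := spectrum.resolvent_sub_resolvent (hres (Metric.sphere_subset_closedBall hw)) (hr hw)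
    have h2 : ‖resolvent b w‖ ≤ ‖resolvent a w‖ + ‖resolvent b w * (b - a) * resolvent a w‖ := by
      rw [← h1]
      simpa using norm_add_le (resolvent a w) (resolvent b w - resolvent a w)
    have h3 : ‖resolvent b w * (b - a) * resolvent a w‖ ≤
        ‖resolvent b w‖ * (‖b - a‖ * ‖resolvent a w‖) := by
      rw [mul_assoc]
      exact (norm_mul_le _ _).trans (by gcongr; exact norm_mul_le _ _)
    have h4 : ‖b - a‖ * ‖resolvent a w‖ ≤ 1 / 2 := by
      have := mul_le_mul_of_nonneg_left (hC1 w hw) (norm_nonneg (b - a))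
      linarith
    have h5 := mul_le_mul_of_nonneg_left h4 (norm_nonneg (resolvent b w))
    linarith [hC1 w hw]
  -- Maximum modulus principle: were the closed disc free of the spectrum of `b`, its resolvent
  -- would be holomorphic there.
  have hcenter : ‖resolvent b z‖ ≤ 2 * (|C| + 1) := by
    refine Complex.norm_le_of_forall_mem_frontier_norm_le (U := Metric.ball z r)
      Metric.isBounded_ball ?_ ?_ (subset_closure (Metric.mem_ball_self hr0))
    · refine DifferentiableOn.diffContOnCl fun w hw => ?_
      rw [closure_ball z hr0.ne'] at hw
      exact (spectrum.hasDerivAt_resolvent_const_left (hres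
        hw)).differentiableAt.differentiableWithinAt
    · rw [frontier_ball z hr0.ne']
      exact hbound
  have hzb : z ∈ resolventSet ℂ b := hres (Metric.mem_closedBall_self hr0.le)
  have : Nontrivial A := by
    rw [← not_subsingleton_iff_nontrivial]
    intro _
    simp at hz
  obtain ⟨U, hU⟩ := spectrum.mem_resolventSet_iff.1 hzb
  rw [resolvent, ← hU, Ring.inverse_unit] at hcenter
  -- `z - a` differs from the unit `z - b` by less than `1 / ‖(z - b)⁻¹‖`, so it is invertible.
  refine hz ⟨Units.ofNearby U (algebraMap ℂ A z - a) ?_, rfl⟩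
  have hsub : algebraMap ℂ A z - a - (U : A) = b - a := by
    rw [hU]
    abel
  rw [hsub, ← one_div, lt_div_iff₀ (Units.norm_pos _)]
  have := mul_le_mul_of_nonneg_left hcenter (norm_nonneg (b - a))
  nlinarith [mul_nonneg (norm_nonneg (b - a)) (by positivity : 0 ≤ |C| + 1)]

/-- Approximate eigenvalues are close to the spectrum. -/
theorem exists_mem_spectrum_of_norm_smul_sub_le [CompleteSpace H] (T : H →L[ℂ] H) {δ : ℝ}
    (hδ : 0 < δ) : ∃ ε > 0, ∀ (z : ℂ) (u : H), u ≠ 0 → ‖z • u - T u‖ ≤ ε * ‖u‖ →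
      ∃ μ ∈ spectrum ℂ T, dist z μ < δ := by
  let K : Set ℂ := Metric.closedBall 0 (‖T‖ + 1) ∩ {z | ∀ μ ∈ spectrum ℂ T, δ ≤ dist z μ}
  have hK : IsCompact K := by
    refine (isCompact_closedBall _ _).inter_right ?_
    simp only [Set.ofPred_forall]
    exact isClosed_biInter fun μ _ =>
      isClosed_le continuous_const (continuous_id.dist continuous_const)
  have hKres : K ⊆ resolventSet ℂ T := fun z hz => by
    by_contra hz'
    have := hz.2 z hz'
    rw [dist_self] at this
    exact hδ.not_ge this
  obtain ⟨C, hC⟩ := hK.exists_bound_of_continuousOn (f := resolvent T) fun w hw =>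
    (spectrum.hasDerivAt_resolvent_const_left (hKres hw)).continuousAt.continuousWithinAt
  -- Here `ε ≤ 1` keeps `z` in the ball of radius `‖T‖ + 1`, and `|C| ε < 1` contradicts `‖u‖ ≤ |C|
  -- ε ‖u‖`.
  refine ⟨1 / (|C| + 1 + 1), by positivity, fun z u hu hzu => ?_⟩
  by_contra! hcon
  have hu' : 0 < ‖u‖ := norm_pos_iff.2 hu
  have hε : 1 / (|C| + 1 + 1) ≤ 1 := by
    rw [div_le_one (by positivity)]
    linarith [abs_nonneg C]
  have hzK : z ∈ K := by
    refine ⟨?_, hcon⟩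
    rw [mem_closedBall_zero_iff]
    have h1 : ‖z‖ * ‖u‖ ≤ (‖T‖ + 1) * ‖u‖ := by
      rw [← norm_smul]
      calc ‖z • u‖ = ‖T u + (z • u - T u)‖ := by congr 1; abel
        _ ≤ ‖T‖ * ‖u‖ + 1 * ‖u‖ := (norm_add_le _ _).trans
          (add_le_add (T.le_opNorm u) (hzu.trans (by gcongr)))
        _ = _ := by ring
    exact le_of_mul_le_mul_right h1 hu'
  have hzr := hKres hzK
  have h1 : resolvent T z (z • u - T u) = u := by
    have : resolvent T z * (algebraMap ℂ _ z - T) = 1 := by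
      rw [spectrum.resolvent_eq hzr]
      exact hzr.val_inv_mul
    simpa [Algebra.algebraMap_eq_smul_one] using congr($this u)
  have h2 : ‖u‖ ≤ |C| * (1 / (|C| + 1 + 1) * ‖u‖) := by
    calc ‖u‖ = ‖resolvent T z (z • u - T u)‖ := by rw [h1]
      _ ≤ ‖resolvent T z‖ * ‖z • u - T u‖ := ContinuousLinearMap.le_opNorm _ _
      _ ≤ _ := by
        gcongr
        exact (hC z hzK).trans (le_abs_self C)
  rw [← mul_assoc, mul_one_div] at h2
  have h3 : |C| / (|C| + 1 + 1) < 1 := by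
    rw [div_lt_one (by positivity)]
    linarith
  nlinarith

theorem mem_spectrum_of_apply_eq_smul [CompleteSpace H] {T : H →L[ℂ] H} {z : ℂ} {u : H}
    (hu : u ≠ 0) (h : T u = z • u) : z ∈ spectrum ℂ T := by
  rintro ⟨U, hU⟩
  apply hu
  have : (algebraMap ℂ (H →L[ℂ] H) z - T) u = 0 := by
    simp [Algebra.algebraMap_eq_smul_one, h]
  rw [← hU] at this
  have hinv := congr($(U.inv_mul) u)
  rw [mul_apply_eq_comp, this, map_zero] at hinv
  exact hinv.symm

/-- An invertible compact operator would make the identity compact and `H` finite-dimensional,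
against the infinite basis. -/
theorem zero_mem_spectrum_of_isCompactOperator [CompleteSpace H] (e : HilbertBasis ℕ ℂ H)
    {T : H →L[ℂ] H} (hT : IsCompactOperator T) : (0 : ℂ) ∈ spectrum ℂ T := by
  rw [spectrum.zero_mem_iff]
  rintro ⟨U, rfl⟩
  have hid : IsCompactOperator (id : H → H) := by
    have h : (↑U⁻¹ : H →L[ℂ] H) ∘ (U : H →L[ℂ] H) = id := funext fun x => congr($(U.inv_mul) x)
    exact h ▸ hT.clm_comp (↑U⁻¹ : H →L[ℂ] H)
  have := FiniteDimensional.of_isCompactOperator_id (𝕜 := ℂ) hid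
  exact not_finite_iff_infinite.2 inferInstance e.orthonormal.linearIndependent.finite

/-- Norm convergence to a compact operator implies lower semicontinuity of the spectrum at each
nonzero point. -/
theorem eventually_exists_mem_spectrum [CompleteSpace H] {T : H →L[ℂ] H} (hT : IsCompactOperator T)
    {S : ℕ → H →L[ℂ] H} (hS : Tendsto S atTop (𝓝 T)) {z : ℂ} (hz : z ∈ spectrum ℂ T) (hz0 : z ≠ 0)
    {δ : ℝ} (hδ : 0 < δ) : ∀ᶠ n in atTop, ∃ w ∈ spectrum ℂ (S n), w ≠ 0 ∧ dist w z < δ := by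
  have hz' : 0 < ‖z‖ := norm_pos_iff.2 hz0
  have hfin := (finite_spectrum_of_isCompactOperator hT (half_pos hz')).image (fun w => dist w z)
  -- A circle of radius below `‖z‖ / 2` meets only points of modulus above `‖z‖ / 2`, where the
  -- spectrum is finite; so `r` can avoid it. The same bound keeps the point found away from `0`.
  obtain ⟨r, hr, hrfin⟩ := ((Set.Ioo_infinite (lt_min hδ (half_pos hz'))).sdiff hfin).nonempty
  obtain ⟨ε, hε, h⟩ := exists_mem_spectrum_of_norm_sub_lt (r := r) hz (fun w hw => by
    by_contra hw'
    refine hrfin ⟨w, ⟨hw', ?_⟩, hw⟩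
    have h1 : ‖z‖ ≤ ‖w‖ + dist w z := by
      rw [dist_comm, dist_eq_norm]
      simpa using norm_add_le w (z - w)
    have h2 : dist w z < ‖z‖ / 2 := by
      rw [Metric.mem_sphere.1 hw]
      exact hr.2.trans_le (min_le_right _ _)
    linarith) hr.1
  filter_upwards [Metric.tendsto_nhds.1 hS ε hε] with n hn
  obtain ⟨w, hw, hwz⟩ := h (S n) (by rwa [← dist_eq_norm])
  refine ⟨w, hw, ?_, hwz.trans_lt (hr.2.trans_le (min_le_left _ _))⟩
  rintro rfl
  rw [dist_comm, dist_zero_right] at hwz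
  linarith [hr.2.trans_le (min_le_right _ _)]

/-! ### Finite sections -/

/-- The isometric embedding of `ℂⁿ` onto the span of the first `n` basis vectors. -/
def coordEmbedding (e : HilbertBasis ℕ ℂ H) (n : ℕ) : EuclideanSpace ℂ (Fin n) →ₗᵢ[ℂ] H :=
  LinearMap.isometryOfOrthonormal
    ((EuclideanSpace.basisFun (Fin n) ℂ).toBasis.constr ℂ fun i => e i)
    (v := (EuclideanSpace.basisFun (Fin n) ℂ).toBasis)
    (by simp)
    (by
      convert e.orthonormal.comp (fun i : Fin n => (i : ℕ)) Fin.val_injective using 1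
      funext i
      simp)

theorem coordEmbedding_apply (e : HilbertBasis ℕ ℂ H) (n : ℕ) (v : EuclideanSpace ℂ (Fin n)) :
    coordEmbedding e n v = ∑ i, v i • e i := by
  change (EuclideanSpace.basisFun (Fin n) ℂ).toBasis.constr ℂ (fun i => e i) v = _
  simp [Module.Basis.constr_apply_fintype]

section CompleteSpace

variable [CompleteSpace H]

/-- The adjoint of `coordEmbedding`: the first `n` coordinates of a vector. -/
def coordMap (e : HilbertBasis ℕ ℂ H) (n : ℕ) : H →L[ℂ] EuclideanSpace ℂ (Fin n) :=
  ContinuousLinearMap.adjoint (coordEmbedding e n).toContinuousLinearMap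

theorem coordMap_apply (e : HilbertBasis ℕ ℂ H) (n : ℕ) (x : H) (i : Fin n) :
    coordMap e n x i = inner ℂ (e i) x := by
  have : coordMap e n x i = inner ℂ (EuclideanSpace.single i (1 : ℂ)) (coordMap e n x) := by
    simp [EuclideanSpace.inner_single_left]
  rw [this, coordMap, ContinuousLinearMap.adjoint_inner_right]
  congr 1
  simp [coordEmbedding_apply]

theorem coordMap_coordEmbedding (e : HilbertBasis ℕ ℂ H) (n : ℕ) (v : EuclideanSpace ℂ (Fin n)) :
    coordMap e n (coordEmbedding e n v) = v := by
  refine ext_inner_left ℂ fun w => ?_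
  rw [coordMap, ContinuousLinearMap.adjoint_inner_right]
  exact (coordEmbedding e n).inner_map_map w v

/-- The orthogonal projection onto the span of the first `n` basis vectors. -/
def coordProj (e : HilbertBasis ℕ ℂ H) (n : ℕ) : H →L[ℂ] H :=
  (coordEmbedding e n).toContinuousLinearMap ∘L coordMap e n

theorem coordProj_apply (e : HilbertBasis ℕ ℂ H) (n : ℕ) (x : H) :
    coordProj e n x = coordEmbedding e n (coordMap e n x) := rfl

theorem norm_coordProj_le (e : HilbertBasis ℕ ℂ H) (n : ℕ) : ‖coordProj e n‖ ≤ 1 := by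
  have h : ‖(coordEmbedding e n).toContinuousLinearMap‖ ≤ 1 :=
    (coordEmbedding e n).norm_toContinuousLinearMap_le
  refine (ContinuousLinearMap.opNorm_comp_le _ _).trans ?_
  refine mul_le_one₀ h (norm_nonneg _) ?_
  rwa [coordMap, LinearIsometryEquiv.norm_map]

theorem adjoint_coordProj (e : HilbertBasis ℕ ℂ H) (n : ℕ) :
    ContinuousLinearMap.adjoint (coordProj e n) = coordProj e n := by
  rw [coordProj, ContinuousLinearMap.adjoint_comp, coordMap, ContinuousLinearMap.adjoint_adjoint]

theorem isCompactOperator_coordProj (e : HilbertBasis ℕ ℂ H) (n : ℕ) :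
    IsCompactOperator (coordProj e n) :=
  (isCompactOperator_of_locallyCompactSpace_rng (coordEmbedding e n).toContinuousLinearMap).comp_clm
    (coordMap e n)

theorem tendsto_coordProj_apply (e : HilbertBasis ℕ ℂ H) (x : H) :
    Tendsto (fun n => coordProj e n x) atTop (𝓝 x) := by
  convert (e.hasSum_repr x).tendsto_sum_nat using 2 with n
  rw [coordProj_apply, coordEmbedding_apply, Finset.sum_range]
  simp [coordMap_apply, e.repr_apply_apply]

/-- Strong convergence of uniformly bounded operators is uniform on compact sets, here one
containing the image of the unit ball. -/
theorem tendsto_coordProj_comp (e : HilbertBasis ℕ ℂ H) {K : H →L[ℂ] H} (hK : IsCompactOperator K) :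
    Tendsto (fun n => coordProj e n ∘L K) atTop (𝓝 K) := by
  obtain ⟨S, hS, hKS⟩ := IsCompactOperator.image_closedBall_subset_compact
    (f := (K : H →ₗ[ℂ] H)) hK 1
  rw [Metric.tendsto_nhds]
  intro ε hε
  obtain ⟨t, -, htfin, ht⟩ := hS.finite_cover_balls (show 0 < ε / 4 by positivity)
  have hev : ∀ᶠ n in atTop, ∀ y ∈ t, dist (coordProj e n y) y < ε / 4 :=
    (eventually_all_finite htfin).2 fun y _ =>
      Metric.tendsto_nhds.1 (tendsto_coordProj_apply e y) _ (by positivity)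
  filter_upwards [hev] with n hn
  rw [dist_eq_norm]
  refine (ContinuousLinearMap.opNorm_le_of_unit_norm (𝕜 := ℂ) (C := 3 * (ε / 4))
    (by positivity) fun x hx => ?_).trans_lt (by linarith)
  have hxS : K x ∈ S := hKS ⟨x, by simp [hx], rfl⟩
  obtain ⟨y, hy, hxy⟩ := Set.mem_iUnion₂.1 (ht hxS)
  rw [Metric.mem_ball, dist_eq_norm] at hxy
  have h1 : ‖coordProj e n (K x - y)‖ ≤ ε / 4 :=
    ((coordProj e n).le_of_opNorm_le (norm_coordProj_le e n) _).trans
      (by rw [one_mul]; exact hxy.le)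
  have h2 : ‖coordProj e n y - y‖ ≤ ε / 4 := by
    rw [← dist_eq_norm]
    exact (hn y hy).le
  have h3 : (coordProj e n ∘L K - K) x =
      coordProj e n (K x - y) + (coordProj e n y - y) - (K x - y) := by
    simp [map_sub]
  rw [h3]
  refine (norm_sub_le _ _).trans ?_
  linarith [norm_add_le (coordProj e n (K x - y)) (coordProj e n y - y)]

/-- Schauder's theorem, from `K* P_n → K*` in norm with each `K* P_n` compact. -/
theorem isCompactOperator_adjoint (e : HilbertBasis ℕ ℂ H) {K : H →L[ℂ] H}
    (hK : IsCompactOperator K) : IsCompactOperator (ContinuousLinearMap.adjoint K) := by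
  have h : Tendsto (fun n => ContinuousLinearMap.adjoint (coordProj e n ∘L K)) atTop
      (𝓝 (ContinuousLinearMap.adjoint K)) :=
    ((ContinuousLinearMap.adjoint (𝕜 := ℂ) (E := H) (F := H)).continuous.tendsto _).comp
      (tendsto_coordProj_comp e hK)
  refine isCompactOperator_of_tendsto h (Eventually.of_forall fun n => ?_)
  rw [ContinuousLinearMap.adjoint_comp, adjoint_coordProj]
  exact (isCompactOperator_coordProj e n).clm_comp (ContinuousLinearMap.adjoint K)

/-- The compression of an operator to the span of the first `n` basis vectors. -/
def compression (e : HilbertBasis ℕ ℂ H) (T : H →L[ℂ] H) (n : ℕ) : H →L[ℂ] H :=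
  coordProj e n ∘L T ∘L coordProj e n

theorem isCompactOperator_compression (e : HilbertBasis ℕ ℂ H) (T : H →L[ℂ] H) (n : ℕ) :
    IsCompactOperator (compression e T n) :=
  (isCompactOperator_coordProj e n).comp_clm (T ∘L coordProj e n)

theorem tendsto_compression (e : HilbertBasis ℕ ℂ H) {K : H →L[ℂ] H} (hK : IsCompactOperator K) :
    Tendsto (compression e K) atTop (𝓝 K) := by
  have h1 := tendsto_coordProj_comp e hK
  -- Convergence on the right is convergence on the left for the adjoint.
  have h2 : Tendsto (fun n => K ∘L coordProj e n) atTop (𝓝 K) := by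
    have := ((ContinuousLinearMap.adjoint (𝕜 := ℂ) (E := H) (F := H)).continuous.tendsto _).comp
      (tendsto_coordProj_comp e (isCompactOperator_adjoint e hK))
    rw [ContinuousLinearMap.adjoint_adjoint] at this
    refine this.congr fun n => ?_
    simp [ContinuousLinearMap.adjoint_comp, adjoint_coordProj]
  rw [tendsto_iff_norm_sub_tendsto_zero] at h1 h2 ⊢
  refine squeeze_zero (fun _ => norm_nonneg _) (fun n => ?_) (by simpa using h2.add h1)
  have h3 : compression e K n - K =
      coordProj e n ∘L (K ∘L coordProj e n - K) + (coordProj e n ∘L K - K) := by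
    ext x
    simp [compression]
  rw [h3]
  refine (norm_add_le _ _).trans (add_le_add ?_ le_rfl)
  refine (ContinuousLinearMap.opNorm_comp_le _ _).trans ?_
  exact mul_le_of_le_one_left (norm_nonneg _) (norm_coordProj_le e n)

/-- The upper left `n × n` block of an infinite matrix. -/
def finiteSection (x : ℕ → ℕ → ℂ) (n : ℕ) : Matrix (Fin n) (Fin n) ℂ :=
  Matrix.of fun i j => x i j

theorem coordMap_apply_coordEmbedding (e : HilbertBasis ℕ ℂ H) (T : H →L[ℂ] H) (n : ℕ)
    (v : EuclideanSpace ℂ (Fin n)) :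
    coordMap e n (T (coordEmbedding e n v)) =
      WithLp.toLp 2 ((finiteSection (matrixElements e T) n).mulVec v.ofLp) := by
  ext i
  rw [coordMap_apply, coordEmbedding_apply]
  simp [finiteSection, matrixElements, Matrix.mulVec, dotProduct, mul_comm]

/-- A nonzero point of the spectrum of a compression is an eigenvalue of the finite section. -/
theorem exists_mulVec_eq_smul (e : HilbertBasis ℕ ℂ H) (T : H →L[ℂ] H) (n : ℕ) {w : ℂ}
    (hw : w ∈ spectrum ℂ (compression e T n)) (hw0 : w ≠ 0) :
    ∃ v : Fin n → ℂ, v ≠ 0 ∧ (finiteSection (matrixElements e T) n).mulVec v = w • v := by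
  obtain ⟨u, hu⟩ := (((isCompactOperator_compression e T n).hasEigenvalue_iff_mem_spectrum
    hw0).2 hw).exists_hasEigenvector
  have hTu : coordEmbedding e n (coordMap e n (T (coordEmbedding e n (coordMap e n u)))) = w • u :=
    hu.apply_eq_smul
  refine ⟨(coordMap e n u).ofLp, fun h => ?_, ?_⟩
  · have h0 : coordMap e n u = 0 := by
      ext i
      exact congr_fun h i
    rw [h0] at hTu
    simp only [map_zero] at hTu
    exact smul_ne_zero hw0 hu.2 hTu.symm
  · have := congr(coordMap e n $hTu)
    rw [coordMap_coordEmbedding, coordMap_apply_coordEmbedding, map_smul] at this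
    exact congr(($this).ofLp)

/-- On the range of `P_n`, `z - T` is `z - P_n T P_n` plus the error `P_n T P_n - T`; the first acts
as the matrix `z - T_n`. -/
theorem norm_smul_sub_coordEmbedding_le (e : HilbertBasis ℕ ℂ H) (T : H →L[ℂ] H) (n : ℕ) (z : ℂ)
    (v : EuclideanSpace ℂ (Fin n)) :
    ‖z • coordEmbedding e n v - T (coordEmbedding e n v)‖ ≤
      ‖WithLp.toLp 2 ((z • 1 - finiteSection (matrixElements e T) n).mulVec v.ofLp)‖ +
        ‖compression e T n - T‖ * ‖coordEmbedding e n v‖ := by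
  have h : z • coordEmbedding e n v - T (coordEmbedding e n v) =
      coordEmbedding e n
        (WithLp.toLp 2 ((z • 1 - finiteSection (matrixElements e T) n).mulVec v.ofLp)) +
      (compression e T n - T) (coordEmbedding e n v) := by
    rw [Matrix.sub_mulVec, Matrix.smul_mulVec, Matrix.one_mulVec, WithLp.toLp_sub, map_sub,
      ← coordMap_apply_coordEmbedding, WithLp.toLp_smul, map_smul, WithLp.toLp_ofLp]
    simp [compression, coordProj_apply, coordMap_coordEmbedding]
  rw [h]
  refine (norm_add_le _ _).trans (add_le_add (le_of_eq ?_) (ContinuousLinearMap.le_opNorm _ _))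
  exact (coordEmbedding e n).norm_map _

end CompleteSpace

/-! ### Detecting small singular values -/

/-- The square of the Frobenius norm of the adjugate. -/
def adjugateNormSq {m : ℕ} (A : Matrix (Fin m) (Fin m) ℂ) : ℝ :=
  ∑ i, ∑ j, ‖A.adjugate i j‖ ^ 2

/-- Multiplying by the adjugate gives `det A • v = c • adj A v`; Cauchy–Schwarz finishes. This is `1
≤ |c| ‖A⁻¹‖` cleared of denominators. -/
theorem norm_det_sq_le {m : ℕ} {A : Matrix (Fin m) (Fin m) ℂ} {v : Fin m → ℂ} {c : ℂ} (hv : v ≠ 0)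
    (h : A.mulVec v = c • v) : ‖A.det‖ ^ 2 ≤ ‖c‖ ^ 2 * adjugateNormSq A := by
  have hdet : A.det • v = c • A.adjugate.mulVec v := by
    rw [← Matrix.mulVec_smul, ← h, Matrix.mulVec_mulVec, Matrix.adjugate_mul, Matrix.smul_mulVec,
      Matrix.one_mulVec]
  have hpos : 0 < ∑ i, ‖v i‖ ^ 2 := by
    obtain ⟨i, hi⟩ := Function.ne_iff.1 hv
    refine Finset.sum_pos' (fun _ _ => by positivity) ⟨i, Finset.mem_univ i, ?_⟩
    have : 0 < ‖v i‖ := norm_pos_iff.2 hi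
    positivity
  refine le_of_mul_le_mul_right ?_ hpos
  calc ‖A.det‖ ^ 2 * ∑ i, ‖v i‖ ^ 2 = ∑ i, ‖(A.det • v) i‖ ^ 2 := by
        simp [Finset.mul_sum, mul_pow]
    _ = ‖c‖ ^ 2 * ∑ i, ‖A.adjugate.mulVec v i‖ ^ 2 := by
        rw [hdet]
        simp [Finset.mul_sum, mul_pow]
    _ ≤ ‖c‖ ^ 2 * ∑ i, (∑ j, ‖A.adjugate i j‖ ^ 2) * ∑ j, ‖v j‖ ^ 2 := by
        gcongr with i
        refine le_trans ?_ (Finset.sum_mul_sq_le_sq_mul_sq _ _ _)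
        gcongr
        simp only [Matrix.mulVec, dotProduct, ← norm_mul]
        exact norm_sum_le _ _
    _ = _ := by rw [← Finset.sum_mul, adjugateNormSq, mul_assoc]

/-- The `j`-th column of `adj A` is sent by `A` to `det A • e_j`, and one of the `m` columns carries
at least the average of the squared norm; this costs the factor `m`. If `det A = 0`, a kernel vector
serves. -/
theorem exists_norm_mulVec_le {m : ℕ} (hm : 0 < m) {A : Matrix (Fin m) (Fin m) ℂ} {κ : ℝ}
    (h : m * κ ^ 2 * ‖A.det‖ ^ 2 ≤ adjugateNormSq A) :
    ∃ v : Fin m → ℂ, v ≠ 0 ∧ κ ^ 2 * ‖WithLp.toLp 2 (A.mulVec v)‖ ^ 2 ≤ ‖WithLp.toLp 2 v‖ ^ 2 := by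
  by_cases hdet : A.det = 0
  · obtain ⟨v, hv, hAv⟩ := Matrix.exists_mulVec_eq_zero_iff.2 hdet
    exact ⟨v, hv, by simp [hAv]⟩
  have : Nonempty (Fin m) := ⟨⟨0, hm⟩⟩
  obtain ⟨j, -, hj⟩ : ∃ j ∈ Finset.univ, κ ^ 2 * ‖A.det‖ ^ 2 ≤ ∑ i, ‖A.adjugate i j‖ ^ 2 := by
    refine Finset.exists_le_of_sum_le Finset.univ_nonempty ?_
    rw [Finset.sum_comm]
    refine le_trans (le_of_eq ?_) h
    simp [mul_assoc]
  have hAv : A.mulVec (fun i => A.adjugate i j) = A.det • Pi.single j 1 := by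
    have := congr(($(A.mul_adjugate)).mulVec (Pi.single j 1))
    rw [← Matrix.mulVec_mulVec, Matrix.smul_mulVec, Matrix.one_mulVec,
      Matrix.mulVec_single_one] at this
    exact this
  refine ⟨fun i => A.adjugate i j, fun h0 => ?_, ?_⟩
  · rw [h0, Matrix.mulVec_zero] at hAv
    exact hdet (by simpa using (congr_fun hAv j).symm)
  · rw [hAv, EuclideanSpace.norm_sq_eq (WithLp.toLp 2 fun i => A.adjugate i j)]
    refine le_trans (le_of_eq ?_) hj
    rw [WithLp.toLp_smul, norm_smul]
    simp

/-! ### The approximating sets -/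

/-- The point of the grid of mesh `m⁻²` with coordinates `q`. -/
def gridPoint (m : ℕ) (q : ℤ × ℤ) : ℂ := (q.1 + q.2 * Complex.I) / (m : ℂ) ^ 2

/-- The indices of the grid points with real and imaginary part in `[-m, m]`. -/
def gridIndices (m : ℕ) : Finset (ℤ × ℤ) :=
  Finset.Icc (-(m : ℤ) ^ 3) ((m : ℤ) ^ 3) ×ˢ Finset.Icc (-(m : ℤ) ^ 3) ((m : ℤ) ^ 3)

theorem exists_int_abs_div_sub_le {m : ℕ} (hm : 0 < m) {t : ℝ} (ht : |t| + 1 ≤ m) :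
    ∃ a ∈ Finset.Icc (-(m : ℤ) ^ 3) ((m : ℤ) ^ 3), |(a : ℝ) / m ^ 2 - t| ≤ 1 / 2 / m ^ 2 := by
  have hm2 : (1 : ℝ) ≤ (m : ℝ) ^ 2 := one_le_pow₀ (by exact_mod_cast hm)
  have hround := abs_sub_round (t * m ^ 2)
  refine ⟨round (t * m ^ 2), ?_, ?_⟩
  · have h1 : |((round (t * (m : ℝ) ^ 2) : ℤ) : ℝ)| ≤ (m : ℝ) ^ 3 := by
      have h2 := abs_sub_abs_le_abs_sub ((round (t * (m : ℝ) ^ 2) : ℤ) : ℝ) (t * m ^ 2)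
      rw [abs_sub_comm, abs_mul, abs_of_pos (show (0 : ℝ) < (m : ℝ) ^ 2 by linarith)] at h2
      nlinarith [mul_le_mul_of_nonneg_right ht (show (0 : ℝ) ≤ (m : ℝ) ^ 2 by linarith)]
    rw [Finset.mem_Icc, ← abs_le]
    exact_mod_cast h1
  · rw [abs_sub_comm, le_div_iff₀ (by linarith)]
    rw [← abs_of_pos (show (0 : ℝ) < (m : ℝ) ^ 2 by linarith), ← abs_mul, abs_of_pos
      (show (0 : ℝ) < (m : ℝ) ^ 2 by linarith)]
    convert hround using 2
    field_simp

theorem exists_gridPoint_near {m : ℕ} (hm : 0 < m) {w : ℂ} (hw : ‖w‖ + 1 ≤ m) :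
    ∃ q ∈ gridIndices m, ‖gridPoint m q - w‖ ≤ 1 / m ^ 2 := by
  obtain ⟨a, ha, ha'⟩ := exists_int_abs_div_sub_le hm (t := w.re)
    (by linarith [Complex.abs_re_le_norm w])
  obtain ⟨b, hb, hb'⟩ := exists_int_abs_div_sub_le hm (t := w.im)
    (by linarith [Complex.abs_im_le_norm w])
  have hre : (gridPoint m (a, b)).re = a / m ^ 2 := by
    rw [gridPoint, ← Nat.cast_pow, Complex.div_natCast_re]
    simp
  have him : (gridPoint m (a, b)).im = b / m ^ 2 := by
    rw [gridPoint, ← Nat.cast_pow, Complex.div_natCast_im]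
    simp
  refine ⟨(a, b), Finset.mk_mem_product ha hb, (Complex.norm_le_abs_re_add_abs_im _).trans ?_⟩
  rw [Complex.sub_re, Complex.sub_im, hre, him]
  refine (add_le_add ha' hb').trans_eq ?_
  ring

/-- The number `0` together with the grid points that are approximate eigenvalues of the finite
section of size `m`. -/
def approxSpectrum (x : ℕ → ℕ → ℂ) (m : ℕ) : Set ℂ :=
  {0} ∪ {z | ∃ q ∈ gridIndices m,
    m * (m : ℝ) ^ 2 * ‖(gridPoint m q • 1 - finiteSection x m).det‖ ^ 2 ≤
    adjugateNormSq (gridPoint m q • 1 - finiteSection x m) ∧ gridPoint m q = z}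

theorem finite_approxSpectrum (x : ℕ → ℕ → ℂ) (m : ℕ) : (approxSpectrum x m).Finite := by
  refine (Set.finite_singleton _).union
    (((gridIndices m).finite_toSet.image (gridPoint m)).subset ?_)
  rintro z ⟨q, hq, -, rfl⟩
  exact ⟨q, hq, rfl⟩

theorem exists_evaluates_approxSpectrum (m : ℕ) : ∃ p : Algorithm (Fin m × Fin m),
    ∀ x : ℕ → ℕ → ℂ, p.Evaluates (fun q => x q.1 q.2) (approxSpectrum x m) := by
  let A : ℤ × ℤ → (Fin m × Fin m → ℂ) → Matrix (Fin m) (Fin m) ℂ := fun q y =>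
    gridPoint m q • 1 - Matrix.of fun i j => y (i, j)
  -- Conjugation writes squared moduli as expressions; `c` is real-valued, so the sign of its real
  -- part is the acceptance test.
  let c : ℤ × ℤ → (Fin m × Fin m → ℂ) → ℂ := fun q y =>
    ((m * m ^ 2 : ℚ) : ℂ) * ((A q y).det * (starRingEnd ℂ) (A q y).det) -
      ∑ i, ∑ j, (A q y).adjugate i j * (starRingEnd ℂ) ((A q y).adjugate i j)
  have hgrid : ∀ q, IsExpressible (fun _ : Fin m × Fin m → ℂ => gridPoint m q) := fun q => by
    have := ((IsExpressible.rat (ι := Fin m × Fin m) q.1).add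
      ((IsExpressible.rat q.2).mul .I)).mul (.rat (1 / (m : ℚ) ^ 2))
    simpa [gridPoint, div_eq_mul_inv] using this
  have hA : ∀ q i j, IsExpressible (fun y => A q y i j) := fun q i j => by
    have h1 : IsExpressible (fun _ : Fin m × Fin m → ℂ =>
        (gridPoint m q • 1 : Matrix _ _ ℂ) i j) := by
      by_cases h : i = j
      · simpa [h] using hgrid q
      · simpa [h] using IsExpressible.rat (ι := Fin m × Fin m) 0
    exact h1.sub (.entry (i, j))
  have hc : ∀ q, IsExpressible (c q) := fun q =>
    ((IsExpressible.rat _).mul ((IsExpressible.det (hA q)).mul (IsExpressible.det (hA q)).conj)).sub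
      (.sum _ fun i => .sum _ fun j =>
        (IsExpressible.adjugate (hA q) i j).mul (IsExpressible.adjugate (hA q) i j).conj)
  have hcre : ∀ q y, (c q y).re = m * (m : ℝ) ^ 2 * ‖(A q y).det‖ ^ 2 - adjugateNormSq (A q y) := by
    intro q y
    have : c q y =
        ((m * (m : ℝ) ^ 2 * ‖(A q y).det‖ ^ 2 - adjugateNormSq (A q y) : ℝ) : ℂ) := by
      simp [c, adjugateNormSq, Complex.mul_conj']
    rw [this, Complex.ofReal_re]
  obtain ⟨p, hp⟩ := Algorithm.exists_evaluates_selection (gridIndices m).toList hc hgrid [.rat 0]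
  refine ⟨p, fun x => ?_⟩
  convert hp fun q => x q.1 q.2 using 1
  simp only [hcre, sub_nonpos]
  ext z
  simp [approxSpectrum, RadicalExpr.eval, A, finiteSection, eq_comm]

/-! ### Convergence of the approximating sets -/

theorem eventually_forall_mem_approxSpectrum [CompleteSpace H] (e : HilbertBasis ℕ ℂ H)
    {T : H →L[ℂ] H} (hT : IsCompactOperator T) {δ : ℝ} (hδ : 0 < δ) :
    ∀ᶠ n : ℕ in atTop, ∀ z ∈ approxSpectrum (matrixElements e T) (n + 1),
      ∃ μ ∈ spectrum ℂ T, dist z μ < δ := by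
  obtain ⟨ε, hε, h⟩ := exists_mem_spectrum_of_norm_smul_sub_le T hδ
  have h1 : Tendsto (fun n : ℕ => 1 / ((n : ℝ) + 1) + ‖compression e T (n + 1) - T‖)
      atTop (𝓝 0) := by
    simpa using tendsto_one_div_add_atTop_nhds_zero_nat.add (tendsto_iff_norm_sub_tendsto_zero.1
      -- The shift to size `n + 1` excludes the empty matrix.
      ((tendsto_compression e hT).comp (tendsto_add_atTop_nat 1)))
  filter_upwards [h1.eventually_le_const hε] with n hn
  rintro z (rfl | ⟨q, -, hq, rfl⟩)
  · exact ⟨0, zero_mem_spectrum_of_isCompactOperator e hT, by simpa using hδ⟩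
  obtain ⟨v, hv, hv'⟩ := exists_norm_mulVec_le n.succ_pos hq
  have hv1 : ‖WithLp.toLp 2 ((gridPoint (n + 1) q • 1 -
      finiteSection (matrixElements e T) (n + 1)).mulVec v)‖ ≤
        1 / ((n : ℝ) + 1) * ‖WithLp.toLp 2 v‖ := by
    rw [← mul_pow, pow_le_pow_iff_left₀ (by positivity) (by positivity) (by norm_num)] at hv'
    rw [one_div, inv_mul_eq_div, le_div_iff₀ (by positivity), mul_comm]
    exact_mod_cast hv'
  refine h _ (coordEmbedding e (n + 1) (WithLp.toLp 2 v)) (fun h0 => hv ?_) ?_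
  · have h1 : WithLp.toLp 2 v = 0 :=
      (coordEmbedding e (n + 1)).injective (h0.trans (map_zero _).symm)
    exact congrArg WithLp.ofLp h1
  · refine (norm_smul_sub_coordEmbedding_le e T (n + 1) _ _).trans ?_
    rw [LinearIsometry.norm_map]
    refine (add_le_add_left hv1 _).trans ?_
    rw [← add_mul]
    gcongr

theorem eventually_exists_mem_approxSpectrum [CompleteSpace H] (e : HilbertBasis ℕ ℂ H)
    {T : H →L[ℂ] H} (hT : IsCompactOperator T) {z : ℂ} (hz : z ∈ spectrum ℂ T) {δ : ℝ} (hδ : 0 < δ) :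
    ∀ᶠ n : ℕ in atTop, ∃ w ∈ approxSpectrum (matrixElements e T) (n + 1), dist z w < δ := by
  rcases eq_or_ne z 0 with rfl | hz0
  · exact Eventually.of_forall fun n => ⟨0, Or.inl rfl, by simpa using hδ⟩
  have h1 := eventually_exists_mem_spectrum hT
    ((tendsto_compression e hT).comp (tendsto_add_atTop_nat 1)) hz hz0 (half_pos hδ)
  have h2 := (tendsto_one_div_add_atTop_nhds_zero_nat (𝕜 := ℝ)).eventually_lt_const (half_pos hδ)
  have h3 := tendsto_natCast_atTop_atTop.eventually_ge_atTop (‖z‖ + δ / 2)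
  filter_upwards [h1, h2, h3] with n hn1 hn2 hn3
  -- The tolerance `δ` is split between the distance from `z` to an eigenvalue `w` of the section
  -- and that from `w` to the grid; `hn3` places `w` well inside the grid square.
  obtain ⟨w, hw, hw0, hwz⟩ := hn1
  obtain ⟨v, hv, hv'⟩ := exists_mulVec_eq_smul e T (n + 1) hw hw0
  have hm : (1 : ℝ) ≤ (n + 1 : ℕ) := by exact_mod_cast n.succ_pos
  have hwn : ‖w‖ + 1 ≤ (n + 1 : ℕ) := by
    have : ‖w‖ ≤ ‖z‖ + dist w z := by
      rw [dist_eq_norm]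
      simpa using norm_add_le z (w - z)
    push_cast
    linarith
  obtain ⟨q, hq, hqw⟩ := exists_gridPoint_near n.succ_pos hwn
  refine ⟨gridPoint (n + 1) q, Or.inr ⟨q, hq, ?_, rfl⟩, ?_⟩
  · have hdet := norm_det_sq_le (A := gridPoint (n + 1) q • 1 -
      finiteSection (matrixElements e T) (n + 1)) (c := gridPoint (n + 1) q - w) hv (by
        rw [Matrix.sub_mulVec, Matrix.smul_mulVec, Matrix.one_mulVec, hv', sub_smul])
    generalize gridPoint (n + 1) q • 1 - finiteSection (matrixElements e T) (n + 1) = A at hdet ⊢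
    generalize ((n + 1 : ℕ) : ℝ) = m at hm hqw ⊢
    have hadj : 0 ≤ adjugateNormSq A := by
      unfold adjugateNormSq
      positivity
    -- The mesh `m⁻²` is chosen for this: the squared distance `m⁻⁴` beats the factor `m³` of the
    -- test.
    have hc : m * m ^ 2 * ‖gridPoint (n + 1) q - w‖ ^ 2 ≤ 1 := by
      calc m * m ^ 2 * ‖gridPoint (n + 1) q - w‖ ^ 2 ≤ m * m ^ 2 * (1 / m ^ 2) ^ 2 := by gcongr
        _ = 1 / m := by field_simp
        _ ≤ 1 := by rw [div_le_one (by linarith)]; exact hm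
    calc m * m ^ 2 * ‖A.det‖ ^ 2
        ≤ m * m ^ 2 * (‖gridPoint (n + 1) q - w‖ ^ 2 * adjugateNormSq A) := by gcongr
      _ = m * m ^ 2 * ‖gridPoint (n + 1) q - w‖ ^ 2 * adjugateNormSq A := by ring
      _ ≤ adjugateNormSq A := mul_le_of_le_one_left hadj hc
  · have h4 : (1 : ℝ) / (n + 1 : ℕ) ^ 2 ≤ 1 / ((n : ℝ) + 1) := by
      push_cast at hm ⊢
      gcongr
      nlinarith
    rw [dist_comm] at hwz
    have h5 : dist w (gridPoint (n + 1) q) ≤ 1 / ((n : ℝ) + 1) := by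
      rw [dist_comm, dist_eq_norm]
      exact hqw.trans h4
    linarith [dist_triangle z w (gridPoint (n + 1) q)]

theorem tendsto_hausdorffEDist_approxSpectrum [CompleteSpace H] (e : HilbertBasis ℕ ℂ H)
    {T : H →L[ℂ] H} (hT : IsCompactOperator T) :
    Tendsto (fun n : ℕ => Metric.hausdorffEDist (approxSpectrum (matrixElements e T) (n + 1))
      (spectrum ℂ T)) atTop (𝓝 0) := by
  rw [ENNReal.tendsto_nhds_zero]
  intro ε hε
  obtain ⟨δ, hδ, hδε⟩ : ∃ δ : ℝ, 0 < δ ∧ ENNReal.ofReal δ ≤ ε := by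
    obtain ⟨d, hd0, hd⟩ := ENNReal.lt_iff_exists_real_btwn.1 hε
    exact ⟨d, by simpa using hd.1, hd.2.le⟩
  -- A finite net in the compact spectrum makes the pointwise approximation uniform.
  obtain ⟨t, htσ, htfin, ht⟩ := (spectrum.isCompact (𝕜 := ℂ) T).finite_cover_balls (half_pos hδ)
  have h1 := (eventually_all_finite htfin).2 fun z hz =>
    eventually_exists_mem_approxSpectrum e hT (htσ hz) (half_pos hδ)
  filter_upwards [h1, eventually_forall_mem_approxSpectrum e hT hδ] with n hn1 hn2
  refine le_trans (Metric.hausdorffEDist_le_of_mem_edist (r := ENNReal.ofReal δ) ?_ ?_) hδε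
  · intro z hz
    obtain ⟨μ, hμ, h⟩ := hn2 z hz
    exact ⟨μ, hμ, by rw [edist_dist]; exact ENNReal.ofReal_le_ofReal h.le⟩
  · intro z hz
    obtain ⟨y, hy, hzy⟩ := Set.mem_iUnion₂.1 (ht hz)
    obtain ⟨w, hw, hyw⟩ := hn1 y hy
    refine ⟨w, hw, ?_⟩
    rw [edist_dist]
    refine ENNReal.ofReal_le_ofReal ((dist_triangle z y w).trans ?_)
    linarith [Metric.mem_ball.1 hzy]

/-- Distance functions differ by at most the Hausdorff distance, and the weights `2^{-i}` sum to
`1`. -/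
theorem attouchWets_le_hausdorffEDist (A B : Closeds ℂ) :
    attouchWets A B ≤ Metric.hausdorffEDist (A : Set ℂ) B := by
  calc attouchWets A B
      ≤ ∑' i : ℕ, (2⁻¹ : ℝ≥0∞) ^ (i + 1) * Metric.hausdorffEDist (A : Set ℂ) B := by
        refine ENNReal.tsum_le_tsum fun i => ?_
        gcongr
        refine (min_le_right _ _).trans (iSup₂_le fun x _ => max_le ?_ ?_)
        · rw [tsub_le_iff_left, Metric.hausdorffEDist_comm]
          exact Metric.infEDist_le_infEDist_add_hausdorffEDist
        · rw [tsub_le_iff_left]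
          exact Metric.infEDist_le_infEDist_add_hausdorffEDist
    _ = Metric.hausdorffEDist (A : Set ℂ) B := by
        rw [ENNReal.tsum_mul_right, ENNReal.tsum_geometric_add_one, ENNReal.one_sub_inv_two,
          inv_inv, ENNReal.inv_mul_cancel (by norm_num) (by norm_num), one_mul]

/-! ### The Solvability Complexity Index -/

theorem matrixElements_injective (e : HilbertBasis ℕ ℂ H) :
    Function.Injective (matrixElements e : (H →L[ℂ] H) → ℕ → ℕ → ℂ) := by
  intro S T h
  refine ContinuousLinearMap.ext_on (s := Set.range e)
    (by rw [dense_iff_closure_eq, ← Submodule.topologicalClosure_coe, e.dense_span]; rfl) ?_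
  rintro _ ⟨j, rfl⟩
  refine e.repr.injective (lp.ext (funext fun i => ?_))
  simpa [e.repr_apply_apply, matrixElements] using congr_fun₂ h i j

theorem solvableWithLimits_one [CompleteSpace H] (e : HilbertBasis ℕ ℂ H) :
    SolvableWithLimits e {T : H →L[ℂ] H | IsCompactOperator T}
      (fun T => closedSpectrum (T : H →L[ℂ] H)) 1 := by
  let Γ : List ℕ → matrixSet e {T : H →L[ℂ] H | IsCompactOperator T} → Closeds ℂ := fun l x =>
    match l with
    -- A chosen operator with matrix `x`; injectivity of `matrixElements` identifies it with the
    -- given one.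
    | [] => closedSpectrum (Classical.choose x.2)
    | n :: _ => ⟨approxSpectrum x.1 (n + 1), (finite_approxSpectrum x.1 (n + 1)).isClosed⟩
  refine ⟨Γ, fun l hl => ?_, fun l hl x => ?_, fun T => ?_⟩
  · obtain ⟨n, rfl⟩ := List.length_eq_one_iff.1 hl
    obtain ⟨p, hp⟩ := exists_evaluates_approxSpectrum (n + 1)
    exact ⟨n + 1, p, fun x => hp x.1⟩
  · obtain rfl : l = [] := by simpa using hl
    obtain ⟨hT, hx⟩ := Classical.choose_spec x.2
    have h := tendsto_hausdorffEDist_approxSpectrum e hT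
    rw [hx] at h
    exact tendsto_of_tendsto_of_tendsto_of_le_of_le tendsto_const_nhds h (fun _ => zero_le)
      fun _ => attouchWets_le_hausdorffEDist _ _
  · have h := (Classical.choose_spec (matrixOf e T).2).2
    exact congrArg closedSpectrum (matrixElements_injective e h)

theorem not_solvableWithLimits_zero [CompleteSpace H] (e : HilbertBasis ℕ ℂ H) :
    ¬ SolvableWithLimits e {T : H →L[ℂ] H | IsCompactOperator T}
      (fun T => closedSpectrum (T : H →L[ℂ] H)) 0 := by
  rintro ⟨p, hp⟩
  obtain ⟨F, hF⟩ := (hp ⟨0, isCompactOperator_zero⟩).exists_finset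
  -- No entry of row `m` is read on input `0`, and the projection `S` onto `e m` has its only
  -- nonzero entry in that row.
  obtain ⟨m, hm⟩ := Infinite.exists_notMem_finset (F.image Prod.fst)
  have hem : e m ≠ 0 := e.orthonormal.ne_zero m
  let S : H →L[ℂ] H := (innerSL ℂ (e m)).smulRight (e m)
  have hSe : ∀ y, S y = inner ℂ (e m) y • e m := fun y => rfl
  have hS : IsCompactOperator S :=
    (isCompactOperator_of_locallyCompactSpace_dom (innerSL ℂ (e m))).clm_comp
      (ContinuousLinearMap.toSpanSingleton ℂ (e m))
  have hmat : ∀ q ∈ F, matrixElements e S q.1 q.2 = matrixElements e (0 : H →L[ℂ] H) q.1 q.2 := by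
    intro q hq
    have hne : q.1 ≠ m := by
      rintro rfl
      exact hm (Finset.mem_image_of_mem _ hq)
    simp [matrixElements, hSe, e.orthonormal.2 hne]
  have heq : spectrum ℂ S = spectrum ℂ (0 : H →L[ℂ] H) := (hp ⟨S, hS⟩).unique (hF _ hmat)
  have : Nontrivial H := ⟨e m, 0, hem⟩
  have h1 : (1 : ℂ) ∈ spectrum ℂ S := mem_spectrum_of_apply_eq_smul hem (by
    rw [hSe, inner_self_eq_norm_sq_to_K, e.orthonormal.1 m]
    simp)
  rw [heq, spectrum.zero_eq] at h1
  exact one_ne_zero h1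

end SolvabilityComplexity

end

theorem mainTheorem1 {H : Type*} [NormedAddCommGroup H] [InnerProductSpace ℂ H] [CompleteSpace H]
    (e : HilbertBasis ℕ ℂ H) :
    SolvabilityComplexity.SCI e {T : H →L[ℂ] H | IsCompactOperator T}
      (fun T => SolvabilityComplexity.closedSpectrum (T : H →L[ℂ] H)) = 1 := by
  refine le_antisymm
    ((iInf₂_le 1 (SolvabilityComplexity.solvableWithLimits_one e)).trans_eq (by simp))
    (le_iInf₂ fun k hk => ?_)
  rcases k with _ | k
  · exact absurd hk (SolvabilityComplexity.not_solvableWithLimits_zero e)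
  · simp
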